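/- Let $d\ge 1$ be an integer and $0<s<1$ with $d>2s$. Write $B_r$ for the open ball of radius $r$ centred at the origin of $\mathbb{R}^d$. For an integer $k\ge 0$ let $C^k(\overline{B_1})$ be the space of functions $\varphi:B_1\to\mathbb{R}$ of class $C^k$ such that $D^\alpha\varphi$ is uniformly continuous on $B_1$ for every multi-index $|\alpha|\le k$, with the norm $\|\varphi\|_{C^k(\overline{B_1})}=\sum_{|\alpha|\le k}\sup_{x\in B_1}|D^\alpha\varphi(x)|$. Let $\mathcal{K}$ be the set of functions $f:B_1\to\mathbb{R}$ for which there is a real-valued $g\in C_c^\infty(B_4\setminus\overline{B_3})$ (extended by zero to $\mathbb{R}^d$) such that $$f(x)=\int_{\mathbb{R}^d}|x-y|^{2s-d}\,g(y)\,dy\qquad (x\in B_1).$$ Then, for every integer $k\ge 0$, $\mathcal{K}$ is a linear subspace of $C^k(\overline{B_1})$ and is dense in $C^k(\overline{B_1})$ with respect to the norm $\|\cdot\|_{C^k(\overline{B_1})}$. -/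

import Mathlib

noncomputable section

/-- Extension by zero to the whole space of a real function on `U ⊆ ℝᵈ`. Its only role is to let
Mathlib's derivatives of functions on `ℝᵈ` be taken at the points of the open set `U`. -/
def zeroExtend {d : ℕ} (U : Set (EuclideanSpace ℝ (Fin d))) (φ : U → ℝ) :
    EuclideanSpace ℝ (Fin d) → ℝ :=
  Function.extend Subtype.val φ 0

/-- The partial derivative `D^α φ : U → ℝ`, for a multi-index `α`, of a function `φ : U → ℝ` on an
open set `U ⊆ ℝᵈ` that is of class `C^{|α|}`: the derivative of order `|α| = ∑ i, α i` evaluated on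
the tuple of standard basis vectors in which `e i` occurs exactly `α i` times. -/
def multiDeriv {d : ℕ} (U : Set (EuclideanSpace ℝ (Fin d))) (α : Fin d → ℕ) (φ : U → ℝ) :
    U → ℝ :=
  fun x => iteratedFDeriv ℝ (∑ i, α i) (zeroExtend U φ) (x : EuclideanSpace ℝ (Fin d))
    (fun j => EuclideanSpace.single (finSigmaFinEquiv.symm j).1 (1 : ℝ))

/-- The space `C^k(closure U)`, for `U ⊆ ℝᵈ` open: the functions `φ : U → ℝ` of class `C^k` all of
whose partial derivatives of order at most `k` are uniformly continuous on bounded subsets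
of `U`. -/
def CkClosure {d : ℕ} (U : Set (EuclideanSpace ℝ (Fin d))) (k : ℕ) : Set (U → ℝ) :=
  {φ | ContDiffOn ℝ (k : WithTop ℕ∞) (zeroExtend U φ) U ∧
    ∀ α : Fin d → ℕ, ∑ i, α i ≤ k →
      ∀ B : Set U, Bornology.IsBounded B → UniformContinuousOn (multiDeriv U α φ) B}

/-- The norm of `C^k(closure U)`: the sum over the multi-indices `α` with `|α| ≤ k` of
`sup {|D^α φ (x)| : x ∈ U}`. It takes values in `[0, ∞]`, so that it carries no junk value. -/
def CkNorm {d : ℕ} (U : Set (EuclideanSpace ℝ (Fin d))) (k : ℕ) (φ : U → ℝ) : ENNReal :=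
  ∑ α ∈ (Fintype.piFinset fun _ : Fin d => Finset.range (k + 1)) with ∑ i, α i ≤ k,
    ⨆ x : U, ENNReal.ofReal |multiDeriv U α φ x|

/-- The kernel `K_β(x) = |x|^β` on `ℝᵈ`. -/
def rieszKernel {d : ℕ} (β : ℝ) (x : EuclideanSpace ℝ (Fin d)) : ℝ :=
  ‖x‖ ^ β

/-- The potential `K_β g (x) = (K_β ∗ g)(x) = ∫ K_β(x - y) g(y) dy`. -/
def rieszPotential {d : ℕ} (β : ℝ) (g : EuclideanSpace ℝ (Fin d) → ℝ)
    (x : EuclideanSpace ℝ (Fin d)) : ℝ :=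
  ∫ y, rieszKernel β (x - y) * g y

/-- The space of all restrictions to `B₁` of potentials `K_{2s-d} g` with `g` smooth and of compact
support contained in the open set `B₄ ∖ closure B₃`. -/
def rieszSpace (d : ℕ) (s : ℝ) :
    Set (Metric.ball (0 : EuclideanSpace ℝ (Fin d)) 1 → ℝ) :=
  {f | ∃ g : EuclideanSpace ℝ (Fin d) → ℝ,
    ContDiff ℝ (⊤ : ℕ∞) g ∧ HasCompactSupport g ∧
      tsupport g ⊆ Metric.ball 0 4 \ closure (Metric.ball 0 3) ∧
      ∀ x : Metric.ball (0 : EuclideanSpace ℝ (Fin d)) 1,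
        f x = rieszPotential (2 * s - d) g x}

end

open MeasureTheory Convolution ContinuousLinearMap Metric Set

/-! ### Derivatives and bounds of convolutions -/

section Convolution

/-! The proof is constructive: it approximates polynomials by potentials and uses that polynomials
are dense in `C^k`. Write `K_γ g` for the potential with kernel `|x - y|^γ`. For `x` in the unit
ball and `y` in the support of `g` one has `2 ≤ |x - y| ≤ 5`, so the singularity is never met and
integration by parts in `y` is free.

The identity `Δ_y |x - y|^γ = γ (γ - 2 + d) |x - y|^(γ - 2)` makes `K_(γ-2) g` a multiple of `K_γ (Δ
g)`. Starting from `γ = 2s - d`, the constant never vanishes, because `2s < d` and `s < 1`; hence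
every `K_(2s-d-2m) g` lies in `rieszSpace`. One derivative gives `K_γ (∂_i g) = γ (x_i K_(γ-2) g -
K_(γ-2) (y_i g))`, so multiplication by `x_i` is possible once the exponent has dropped by two. By
induction `p · K_(2s-d-2m) g` lies in the space for each polynomial `p` and all large `m`
(`exists_isRieszMultiplier_eval`).

By Weierstrass in the variable `ρ⁻²`, a combination of the powers `ρ^(2s-d-2m)` with `m` large is
uniformly close to one on `[2, 5]`. If `∫ g = 1`, the same combination of potentials is close to one
in `C^k`: the derivatives fall on `g`, so uniform closeness of the kernels suffices. Multiplying by
`p` approximates `p` (`exists_rieszSpace_near_eval`). Finally, polynomials are dense in `C^k` by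
dilation, cutoff and convolution with a polynomial close to a bump. -/

theorem convolution_lsmul_precompR {E F : Type*} [NormedAddCommGroup E] [NormedSpace ℝ E]
    [MeasurableSpace E] [NormedAddCommGroup F] [NormedSpace ℝ F] {μ : Measure E}
    {H : E → ℝ} (W : E → E →L[ℝ] F) (x : E) :
    (H ⋆[(lsmul ℝ ℝ : ℝ →L[ℝ] F →L[ℝ] F).precompR E, μ] W) x = (H ⋆[lsmul ℝ ℝ, μ] W) x := by
  simp only [convolution_def]
  congr 1

/-- Only the values of `H` on `x - supp w` enter, so a kernel that is small there, and arbitrary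
elsewhere, is enough. -/
theorem norm_convolution_lsmul_le {E F : Type*} [NormedAddCommGroup E]
    [MeasurableSpace E] [BorelSpace E] [NormedAddCommGroup F] [NormedSpace ℝ F] {μ : Measure E}
    [μ.IsAddLeftInvariant] [μ.IsNegInvariant]
    {H : E → ℝ} {w : E → F} (hw : Integrable w μ) {C : ℝ} {x : E}
    (hC : ∀ y ∈ tsupport w, |H (x - y)| ≤ C) :
    ‖(H ⋆[lsmul ℝ ℝ, μ] w) x‖ ≤ C * ∫ y, ‖w y‖ ∂μ := by
  rw [convolution_eq_swap, ← integral_const_mul]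
  refine norm_integral_le_of_norm_le (hw.norm.const_mul C) (Filter.Eventually.of_forall fun y => ?_)
  simp only [lsmul_apply, norm_smul, Real.norm_eq_abs]
  by_cases hy : y ∈ tsupport w
  · exact mul_le_mul_of_nonneg_right (hC y hy) (norm_nonneg _)
  · simp [image_eq_zero_of_notMem_tsupport hy]

variable {E F : Type*} [NormedAddCommGroup E] [NormedSpace ℝ E] [MeasurableSpace E] [BorelSpace E]
  [NormedAddCommGroup F] [NormedSpace ℝ F] {μ : Measure E}

/-- The derivatives of a convolution with a compactly supported function of class `C^n` fall on
that function. -/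
theorem iteratedFDeriv_convolution_lsmul [SFinite μ] [μ.IsAddLeftInvariant]
    {H : E → ℝ} (hH : LocallyIntegrable H μ) {w : E → F} {n : ℕ} (hw : HasCompactSupport w)
    (hc : ContDiff ℝ n w) {j : ℕ} (hj : j ≤ n) :
    iteratedFDeriv ℝ j (H ⋆[lsmul ℝ ℝ, μ] w) = H ⋆[lsmul ℝ ℝ, μ] iteratedFDeriv ℝ j w := by
  induction j with
  | zero =>
    ext1 x
    rw [iteratedFDeriv_zero_eq_comp, iteratedFDeriv_zero_eq_comp]
    simp only [Function.comp, convolution_def, lsmul_apply]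
    rw [← LinearIsometryEquiv.coe_toContinuousLinearEquiv, ← ContinuousLinearEquiv.integral_comp_comm]
    simp
  | succ j ih =>
    ext1 x
    have hc1 : ContDiff ℝ 1 (iteratedFDeriv ℝ j w) :=
      hc.iteratedFDeriv_right (by exact_mod_cast (by omega : 1 + j ≤ n))
    rw [iteratedFDeriv_succ_eq_comp_left, iteratedFDeriv_succ_eq_comp_left, ih (by omega)]
    simp only [Function.comp]
    rw [((hw.iteratedFDeriv j).hasFDerivAt_convolution_right (lsmul ℝ ℝ) hH hc1 x).fderiv,
      convolution_lsmul_precompR]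
    simp only [convolution_def, lsmul_apply]
    refine (ContinuousLinearEquiv.integral_comp_comm (𝕜 := ℝ) (X := E) (μ := μ)
      (E := E →L[ℝ] E [×j]→L[ℝ] F)
      (F := E [×(j + 1)]→L[ℝ] F) (continuousMultilinearCurryLeftEquiv ℝ
      (fun _ : Fin (j + 1) => E) F).symm.toContinuousLinearEquiv _).symm.trans ?_
    congr 1 with t : 1

/-- This turns a uniform bound on the kernel into a `C^n` bound on the convolution, with no
derivative of `H` involved. It serves both approximations below. -/
theorem norm_iteratedFDeriv_convolution_lsmul_le [SFinite μ] [μ.IsAddLeftInvariant]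
    [μ.IsNegInvariant] [IsFiniteMeasureOnCompacts μ] {H : E → ℝ}
    (hH : LocallyIntegrable H μ) {w : E → F} {n : ℕ}
    (hw : HasCompactSupport w) (hc : ContDiff ℝ n w) {j : ℕ} (hj : j ≤ n) {C : ℝ} {x : E}
    (hC : ∀ y ∈ tsupport w, |H (x - y)| ≤ C) :
    ‖iteratedFDeriv ℝ j (H ⋆[lsmul ℝ ℝ, μ] w) x‖ ≤ C * ∫ y, ‖iteratedFDeriv ℝ j w y‖ ∂μ := by
  rw [iteratedFDeriv_convolution_lsmul hH hw hc hj]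
  refine norm_convolution_lsmul_le ?_ fun y hy => hC y (tsupport_iteratedFDeriv_subset j hy)
  exact (hc.continuous_iteratedFDeriv (by exact_mod_cast hj)).integrable_of_hasCompactSupport
    (hw.iteratedFDeriv j)

end Convolution

/-! ### Polynomial approximation, uniformly and in `C^k` -/

section Polynomial

variable {d : ℕ}

theorem contDiff_mvPolynomial_eval {n : WithTop ℕ∞} (p : MvPolynomial (Fin d) ℝ) :
    ContDiff ℝ n fun x : EuclideanSpace ℝ (Fin d) => MvPolynomial.eval x p := by
  induction p using MvPolynomial.induction_on with
  | C a => simpa using contDiff_const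
  | add p q hp hq => simpa using hp.add hq
  | mul_X p i hp =>
    simp only [map_mul, MvPolynomial.eval_X]
    exact hp.mul (contDiff_euclidean.1 contDiff_id i)

/-- The convolution of a polynomial with a compactly supported function is a polynomial. -/
theorem exists_mvPolynomial_convolution (L : MvPolynomial (Fin d) ℝ) :
    ∀ w : EuclideanSpace ℝ (Fin d) → ℝ, Continuous w → HasCompactSupport w →
      ∃ p : MvPolynomial (Fin d) ℝ, ∀ x : EuclideanSpace ℝ (Fin d),
        ((fun z : EuclideanSpace ℝ (Fin d) => MvPolynomial.eval z L) ⋆[lsmul ℝ ℝ, volume] w) x =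
          MvPolynomial.eval x p := by
  have hint : ∀ (p : MvPolynomial (Fin d) ℝ) (w : EuclideanSpace ℝ (Fin d) → ℝ), Continuous w →
      HasCompactSupport w → ∀ x : EuclideanSpace ℝ (Fin d),
      Integrable (fun y => MvPolynomial.eval (x - y).ofLp p * w y) := by
    intro p w hw hs x
    refine Continuous.integrable_of_hasCompactSupport ?_ hs.mul_left
    exact (((contDiff_mvPolynomial_eval (n := 0) p).continuous.comp
      (continuous_const.sub continuous_id))).mul hw
  simp only [convolution_eq_swap, lsmul_apply, smul_eq_mul]
  induction L using MvPolynomial.induction_on with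
  | C a =>
    intro w _ _
    exact ⟨MvPolynomial.C (∫ y, a * w y), fun x => by simp⟩
  | add p q hp hq =>
    intro w hw hs
    obtain ⟨P, hP⟩ := hp w hw hs
    obtain ⟨Q, hQ⟩ := hq w hw hs
    refine ⟨P + Q, fun x => ?_⟩
    rw [map_add, ← hP, ← hQ, ← integral_add (hint p w hw hs x) (hint q w hw hs x)]
    simp only [map_add, add_mul]
  | mul_X p i hp =>
    intro w hw hs
    have hw' : Continuous fun y : EuclideanSpace ℝ (Fin d) => y i * w y := by fun_prop
    have hs' : HasCompactSupport fun y : EuclideanSpace ℝ (Fin d) => y i * w y := hs.mul_left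
    obtain ⟨P, hP⟩ := hp w hw hs
    obtain ⟨Q, hQ⟩ := hp _ hw' hs'
    -- The new factor is `x i - y i`: the first term leaves the integral, the second is absorbed in
    -- the density. This is why the induction quantifies over all `w`.
    refine ⟨MvPolynomial.X i * P - Q, fun x => ?_⟩
    rw [map_sub, map_mul, ← hP, ← hQ, MvPolynomial.eval_X, ← integral_const_mul,
      ← integral_sub ((hint p w hw hs x).const_mul _) (hint p _ hw' hs' x)]
    congr 1 with y
    simp only [map_mul, MvPolynomial.eval_X, PiLp.sub_apply]
    ring

/-- The Weierstrass approximation theorem on a compact subset of Euclidean space. -/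
theorem exists_mvPolynomial_near {S : Set (EuclideanSpace ℝ (Fin d))} (hS : IsCompact S)
    {f : EuclideanSpace ℝ (Fin d) → ℝ} (hf : Continuous f) {ε : ℝ} (hε : 0 < ε) :
    ∃ p : MvPolynomial (Fin d) ℝ, ∀ x ∈ S, |MvPolynomial.eval x p - f x| < ε := by
  have := isCompact_iff_compactSpace.1 hS
  let c : Fin d → C(S, ℝ) := fun i => ⟨fun x => x.1 i, by fun_prop⟩
  have key : ∀ (p : MvPolynomial (Fin d) ℝ) (x : S),
      MvPolynomial.aeval c p x = MvPolynomial.eval x.1 p := by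
    intro p x
    induction p using MvPolynomial.induction_on with
    | C a => simp
    | add p q hp hq => simp [hp, hq]
    | mul_X p i hp => simp [hp, c]
  -- Stone–Weierstrass: the coordinate functions separate points.
  have htop : (MvPolynomial.aeval (R := ℝ) c).range.topologicalClosure = ⊤ := by
    refine ContinuousMap.subalgebra_topologicalClosure_eq_top_of_separatesPoints _ ?_
    intro x y hxy
    have : ∃ i, x.1 i ≠ y.1 i := by
      by_contra! h
      exact hxy (Subtype.ext (PiLp.ext h))
    obtain ⟨i, hi⟩ := this
    exact ⟨c i, ⟨c i, ⟨MvPolynomial.X i, by simp⟩, rfl⟩, hi⟩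
  let g : C(S, ℝ) := ⟨fun x => f x, by fun_prop⟩
  have hg : g ∈ closure ((MvPolynomial.aeval (R := ℝ) c).range : Set C(S, ℝ)) := by
    rw [← Subalgebra.topologicalClosure_coe, htop]; trivial
  obtain ⟨_, ⟨p, rfl⟩, hp⟩ := Metric.mem_closure_iff.1 hg ε hε
  refine ⟨p, fun x hx => ?_⟩
  have := (ContinuousMap.dist_lt_iff hε).1 hp ⟨x, hx⟩
  rw [dist_comm, Real.dist_eq] at this
  simpa [key, g] using this

end Polynomial

/-- A compactly supported function of class `C^k` is approximated by polynomials on the unit ball,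
together with its derivatives of order at most `k`. -/
theorem exists_mvPolynomial_iteratedFDeriv_near {d k : ℕ} {w : EuclideanSpace ℝ (Fin d) → ℝ}
    (hw : HasCompactSupport w) (hc : ContDiff ℝ k w) {ε : ℝ} (hε : 0 < ε) :
    ∃ p : MvPolynomial (Fin d) ℝ, ∀ x ∈ ball (0 : EuclideanSpace ℝ (Fin d)) 1, ∀ j ≤ k,
      ‖iteratedFDeriv ℝ j (fun x => w x - MvPolynomial.eval x p) x‖ ≤ ε := by
  have hcj : ∀ j ≤ k, Continuous (iteratedFDeriv ℝ j w) := fun j hj =>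
    hc.continuous_iteratedFDeriv (by exact_mod_cast hj)
  have hδ : ∃ δ > 0, ∀ j ≤ k, ∀ x y : EuclideanSpace ℝ (Fin d), dist x y < δ →
      dist (iteratedFDeriv ℝ j w x) (iteratedFDeriv ℝ j w y) ≤ ε / 2 := by
    have h1 : ∀ j ≤ k, ∃ δ > 0, ∀ x y : EuclideanSpace ℝ (Fin d), dist x y < δ →
        dist (iteratedFDeriv ℝ j w x) (iteratedFDeriv ℝ j w y) ≤ ε / 2 := by
      intro j hj
      obtain ⟨δ, h0, h⟩ := Metric.uniformContinuous_iff.1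
        ((hw.iteratedFDeriv j).uniformContinuous_of_continuous (hcj j hj)) (ε / 2) (by positivity)
      exact ⟨δ, h0, fun x y hxy => (h hxy).le⟩
    choose! δ h0 h using h1
    refine ⟨(Finset.range (k + 1)).inf' Finset.nonempty_range_add_one δ, ?_, fun j hj x y hxy => ?_⟩
    · rw [gt_iff_lt, Finset.lt_inf'_iff]
      exact fun j hj => h0 j (by simpa [Nat.lt_succ_iff] using hj)
    · exact h j hj x y (hxy.trans_le (Finset.inf'_le _ (by simpa [Nat.lt_succ_iff] using hj)))
  obtain ⟨δ, h0, hδ⟩ := hδ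
  let φ : ContDiffBump (0 : EuclideanSpace ℝ (Fin d)) := ⟨δ / 2, δ, by linarith, by linarith⟩
  obtain ⟨R, hR⟩ := hw.isCompact.isBounded.subset_closedBall (0 : EuclideanSpace ℝ (Fin d))
  let M : ℝ := ∑ j ∈ Finset.range (k + 1), ∫ y, ‖iteratedFDeriv ℝ j w y‖
  have hM0 : 0 ≤ M := Finset.sum_nonneg fun j _ => integral_nonneg fun _ => norm_nonneg _
  have hM : ∀ j ≤ k, ∫ y, ‖iteratedFDeriv ℝ j w y‖ ≤ M := fun j hj =>
    Finset.single_le_sum (f := fun j => ∫ y, ‖iteratedFDeriv ℝ j w y‖)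
      (fun j _ => integral_nonneg fun _ => norm_nonneg _) (by simpa [Nat.lt_succ_iff] using hj)
  have hφc : Continuous (φ.normed volume) := φ.continuous_normed
  -- For `|x| < 1` and `y` in the support of `w`, the difference `x - y` has norm at most `1 + R`.
  -- `M` bounds the `L¹` norms of the derivatives of `w`, and `+ 1` keeps the denominator positive.
  obtain ⟨L, hL⟩ := exists_mvPolynomial_near (isCompact_closedBall 0 (1 + R)) hφc
    (ε := ε / 2 / (M + 1)) (by positivity)
  obtain ⟨p, hp⟩ := exists_mvPolynomial_convolution L w hc.continuous hw
  refine ⟨p, fun x hx j hj => ?_⟩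
  have hLc : Continuous fun z : EuclideanSpace ℝ (Fin d) => MvPolynomial.eval z L :=
    (contDiff_mvPolynomial_eval (n := 0) L).continuous
  have hHc := hLc.sub hφc
  -- With `p = L ∗ w`, the error splits into the mollification error `w - φ ∗ w` and the kernel
  -- error `(L - φ) ∗ w`.
  have hfun : (fun x : EuclideanSpace ℝ (Fin d) => w x - MvPolynomial.eval x p) =
      w - (φ.normed volume ⋆[lsmul ℝ ℝ, volume] w) -
        (((fun z : EuclideanSpace ℝ (Fin d) => MvPolynomial.eval z L) - φ.normed volume)
          ⋆[lsmul ℝ ℝ, volume] w) := by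
    ext x
    have h1 := (hw.convolutionExists_right (lsmul ℝ ℝ : ℝ →L[ℝ] ℝ →L[ℝ] ℝ) (μ := volume)
      hHc.locallyIntegrable hc.continuous).add_distrib
      (hw.convolutionExists_right (lsmul ℝ ℝ : ℝ →L[ℝ] ℝ →L[ℝ] ℝ) (μ := volume)
      hφc.locallyIntegrable hc.continuous)
    have h2 := congrFun h1 x
    rw [sub_add_cancel, hp] at h2
    simp only [Pi.sub_apply, Pi.add_apply, h2]
    ring
  have hca : ContDiff ℝ k (φ.normed volume ⋆[lsmul ℝ ℝ, volume] w) := by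
    exact_mod_cast hw.contDiff_convolution_right (n := k) (lsmul ℝ ℝ) hφc.locallyIntegrable
      (by exact_mod_cast hc)
  have hcb : ContDiff ℝ k (((fun z : EuclideanSpace ℝ (Fin d) => MvPolynomial.eval z L) -
      φ.normed volume) ⋆[lsmul ℝ ℝ, volume] w) := by
    exact_mod_cast hw.contDiff_convolution_right (n := k) (lsmul ℝ ℝ) hHc.locallyIntegrable
      (by exact_mod_cast hc)
  have hjk : (j : WithTop ℕ∞) ≤ k := by exact_mod_cast hj
  have hcc : ContDiff ℝ k (w - (φ.normed volume ⋆[lsmul ℝ ℝ, volume] w)) := hc.sub hca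
  rw [hfun, iteratedFDeriv_sub_apply (hcc.of_le hjk).contDiffAt (hcb.of_le hjk).contDiffAt,
    iteratedFDeriv_sub_apply (hc.of_le hjk).contDiffAt (hca.of_le hjk).contDiffAt]
  refine (norm_sub_le _ _).trans ?_
  have e1 : ‖iteratedFDeriv ℝ j w x -
      iteratedFDeriv ℝ j (φ.normed volume ⋆[lsmul ℝ ℝ, volume] w) x‖ ≤ ε / 2 := by
    rw [iteratedFDeriv_convolution_lsmul hφc.locallyIntegrable hw hc hj, ← dist_eq_norm, dist_comm]
    exact φ.dist_normed_convolution_le (hcj j hj).aestronglyMeasurable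
      fun y hy => hδ j hj y x (mem_ball.1 hy)
  have e2 : ‖iteratedFDeriv ℝ j (((fun z : EuclideanSpace ℝ (Fin d) => MvPolynomial.eval z L) -
      φ.normed volume) ⋆[lsmul ℝ ℝ, volume] w) x‖ ≤ ε / 2 := by
    refine (norm_iteratedFDeriv_convolution_lsmul_le hHc.locallyIntegrable hw hc hj
      (C := ε / 2 / (M + 1)) fun y hy => ?_).trans ?_
    · refine (hL _ ?_).le
      have h1 := mem_closedBall_zero_iff.1 (hR hy)
      have h2 := mem_ball_zero_iff.1 hx
      exact mem_closedBall_zero_iff.2 ((norm_sub_le _ _).trans (by linarith))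
    · rw [div_mul_eq_mul_div, div_le_iff₀ (by positivity)]
      exact mul_le_mul_of_nonneg_left ((hM j hj).trans (by linarith)) (by positivity)
  linarith

/-! ### Partial derivatives, the `C^k` norm, and reduction to compact support -/

section MultiDeriv

variable {d : ℕ}

/-- The tuple of standard basis vectors in which `e i` occurs exactly `α i` times. -/
noncomputable def basisTuple (α : Fin d → ℕ) : Fin (∑ i, α i) → EuclideanSpace ℝ (Fin d) :=
  fun j => EuclideanSpace.single (finSigmaFinEquiv.symm j).1 (1 : ℝ)

theorem norm_apply_basisTuple_le (α : Fin d → ℕ)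
    (T : EuclideanSpace ℝ (Fin d) [×(∑ i, α i)]→L[ℝ] ℝ) : |T (basisTuple α)| ≤ ‖T‖ := by
  refine (T.le_opNorm _).trans_eq ?_
  simp [basisTuple]

theorem zeroExtend_eventuallyEq {U : Set (EuclideanSpace ℝ (Fin d))} (hU : IsOpen U) {φ : U → ℝ}
    {F : EuclideanSpace ℝ (Fin d) → ℝ} (h : ∀ x : U, φ x = F x) {x : EuclideanSpace ℝ (Fin d)}
    (hx : x ∈ U) : zeroExtend U φ =ᶠ[nhds x] F := by
  filter_upwards [hU.mem_nhds hx] with y hy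
  exact (Subtype.val_injective.extend_apply φ 0 ⟨y, hy⟩).trans (h ⟨y, hy⟩)

theorem multiDeriv_eq {U : Set (EuclideanSpace ℝ (Fin d))} (hU : IsOpen U) {φ : U → ℝ}
    {F : EuclideanSpace ℝ (Fin d) → ℝ} (h : ∀ x : U, φ x = F x) (α : Fin d → ℕ) (x : U) :
    multiDeriv U α φ x = iteratedFDeriv ℝ (∑ i, α i) F x (basisTuple α) := by
  unfold multiDeriv
  rw [((zeroExtend_eventuallyEq hU h x.2).iteratedFDeriv ℝ _).eq_of_nhds]
  rfl

/-- Restrictions of functions that are smooth on the whole space belong to `C^k(closure U)`. -/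
theorem mem_CkClosure_of_contDiff {U : Set (EuclideanSpace ℝ (Fin d))} (hU : IsOpen U)
    {φ : U → ℝ} {F : EuclideanSpace ℝ (Fin d) → ℝ} {k : ℕ} (h : ∀ x : U, φ x = F x)
    (hF : ContDiff ℝ k F) : φ ∈ CkClosure U k := by
  refine ⟨fun x hx => ((hF.contDiffAt.congr_of_eventuallyEq
    (zeroExtend_eventuallyEq hU h hx))).contDiffWithinAt, fun α hα B hB => ?_⟩
  have hc : Continuous fun x => iteratedFDeriv ℝ (∑ i, α i) F x (basisTuple α) :=
    (ContinuousMultilinearMap.apply ℝ _ _ (basisTuple α)).continuous.comp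
      (hF.continuous_iteratedFDeriv (by exact_mod_cast hα))
  have hB' : Bornology.IsBounded (Subtype.val '' B) :=
    (LipschitzWith.subtype_val U).isBounded_image hB
  have h1 := (hB'.isCompact_closure.uniformContinuousOn_of_continuous hc.continuousOn).mono
    subset_closure
  have h2 : multiDeriv U α φ = (fun x => iteratedFDeriv ℝ (∑ i, α i) F x (basisTuple α)) ∘
      Subtype.val := funext fun x => multiDeriv_eq hU h α x
  rw [h2]
  exact h1.comp uniformContinuous_subtype_val.uniformContinuousOn (mapsTo_image _ _)

theorem CkNorm_lt_of_forall_le {U : Set (EuclideanSpace ℝ (Fin d))} {k : ℕ} {ε : ℝ} (hε : 0 < ε) :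
    ∃ η > 0, ∀ φ : U → ℝ, (∀ α : Fin d → ℕ, ∑ i, α i ≤ k → ∀ x, |multiDeriv U α φ x| ≤ η) →
      CkNorm U k φ < ENNReal.ofReal ε := by
  set A := (Fintype.piFinset fun _ : Fin d => Finset.range (k + 1)).filter fun α => ∑ i, α i ≤ k
    with hA
  refine ⟨ε / 2 / (A.card + 1), by positivity, fun φ hφ => ?_⟩
  have h1 : CkNorm U k φ ≤ ∑ α ∈ A, ENNReal.ofReal (ε / 2 / (A.card + 1)) := by
    refine Finset.sum_le_sum fun α hα => iSup_le fun x => ENNReal.ofReal_le_ofReal ?_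
    exact hφ α (Finset.mem_filter.1 hα).2 x
  refine h1.trans_lt ?_
  rw [← ENNReal.ofReal_sum_of_nonneg fun _ _ => by positivity, Finset.sum_const, nsmul_eq_mul]
  refine (ENNReal.ofReal_lt_ofReal_iff hε).2 ?_
  rw [mul_div_assoc', div_lt_iff₀ (by positivity)]
  nlinarith [A.card.cast_nonneg (α := ℝ)]

theorem iteratedFDeriv_comp_smul_of_ne_zero {E F : Type*} [NormedAddCommGroup E] [NormedSpace ℝ E]
    [NormedAddCommGroup F] [NormedSpace ℝ F] (f : E → F) {r : ℝ} (hr : r ≠ 0) (j : ℕ) (x : E) :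
    iteratedFDeriv ℝ j (fun z => f (r • z)) x = r ^ j • iteratedFDeriv ℝ j f (r • x) := by
  have h := (ContinuousLinearEquiv.smulLeft (M₁ := E) (Units.mk0 r hr)
    : E ≃L[ℝ] E).iteratedFDerivWithin_comp_right f
    uniqueDiffOn_univ (mem_univ (r • x)) j
  simp only [preimage_univ, iteratedFDerivWithin_univ] at h
  refine h.trans ?_
  ext m
  simp only [ContinuousMultilinearMap.compContinuousLinearMap_apply,
    _root_.smul_apply]
  have := (iteratedFDeriv ℝ j f (r • x)).map_smul_univ (fun _ => r) m
  simp only [Finset.prod_const, Finset.card_univ, Fintype.card_fin] at this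
  exact this

/-- The ball is totally bounded, and uniformly continuous maps preserve total boundedness. -/
theorem bounded_of_uniformContinuous_ball {f : ball (0 : EuclideanSpace ℝ (Fin d)) 1 → ℝ}
    (hf : UniformContinuous f) : ∃ M : ℝ, 0 ≤ M ∧ ∀ x, |f x| ≤ M := by
  have h1 : TotallyBounded (univ : Set (ball (0 : EuclideanSpace ℝ (Fin d)) 1)) := by
    have := totallyBounded_preimage (s := ball (0 : EuclideanSpace ℝ (Fin d)) 1)
      (f := (Subtype.val : ball (0 : EuclideanSpace ℝ (Fin d)) 1 → _))
      isUniformEmbedding_subtype_val.isUniformInducing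
      ((isCompact_closedBall _ _).totallyBounded.subset ball_subset_closedBall)
    convert this
    ext ⟨x, hx⟩
    simp
  obtain ⟨M, hM⟩ := (h1.image hf).isBounded.exists_norm_le
  refine ⟨max M 0, le_max_right _ _, fun x => (hM _ ⟨x, mem_univ _, rfl⟩).trans (le_max_left _ _)⟩

theorem contDiff_bump_mul {E : Type*} [NormedAddCommGroup E] [NormedSpace ℝ E]
    {n : WithTop ℕ∞} {χ f : E → ℝ} {U : Set E} (hU : IsOpen U) (hχ : ContDiff ℝ n χ)
    (hf : ContDiffOn ℝ n f U) (hs : tsupport χ ⊆ U) : ContDiff ℝ n fun x => χ x * f x := by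
  refine contDiff_iff_contDiffAt.2 fun x => ?_
  by_cases hx : x ∈ tsupport χ
  · exact hχ.contDiffAt.mul (hf.contDiffAt (hU.mem_nhds (hs hx)))
  · refine contDiffAt_const (c := (0 : ℝ)) |>.congr_of_eventuallyEq ?_
    filter_upwards [notMem_tsupport_iff_eventuallyEq.1 hx] with y hy
    simp [hy]

/-- Functions in `C^k(closure B₁)` are approximated by compactly supported functions of class `C^k`
on the whole space. -/
theorem exists_compactSupport_near {k : ℕ} {u : ball (0 : EuclideanSpace ℝ (Fin d)) 1 → ℝ}
    (hu : u ∈ CkClosure (ball 0 1) k) {ε : ℝ} (hε : 0 < ε) :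
    ∃ w : EuclideanSpace ℝ (Fin d) → ℝ, HasCompactSupport w ∧ ContDiff ℝ k w ∧
      ∀ α : Fin d → ℕ, ∑ i, α i ≤ k → ∀ x : ball (0 : EuclideanSpace ℝ (Fin d)) 1,
        |multiDeriv (ball 0 1) α u x - iteratedFDeriv ℝ (∑ i, α i) w x (basisTuple α)| ≤ ε := by
  obtain ⟨hu1, hu2⟩ := hu
  set V := zeroExtend (ball (0 : EuclideanSpace ℝ (Fin d)) 1) u
  have hrx : ∀ r ∈ Ioo (0 : ℝ) 1, ∀ x : ball (0 : EuclideanSpace ℝ (Fin d)) 1,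
        r • (x : EuclideanSpace ℝ (Fin d)) ∈ ball (0 : EuclideanSpace ℝ (Fin d)) 1 := by
    intro r hr x
    have := mem_ball_zero_iff.1 x.2
    rw [mem_ball_zero_iff, norm_smul, Real.norm_eq_abs, abs_of_pos hr.1]
    nlinarith [hr.2, norm_nonneg (x : EuclideanSpace ℝ (Fin d)), hr.1]
  -- The dilate `V (r • x)` with `r < 1` is `C^k` on a larger ball. Its derivatives tend to those of
  -- `u` uniformly as `r → 1`, by uniform continuity and boundedness of the latter.
  have key : ∀ α : Fin d → ℕ, ∑ i, α i ≤ k → ∀ᶠ r in nhdsWithin (1 : ℝ) (Ioo 0 1),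
      ∀ x : ball (0 : EuclideanSpace ℝ (Fin d)) 1,
        |multiDeriv (ball 0 1) α u x - r ^ (∑ i, α i) *
        iteratedFDeriv ℝ (∑ i, α i) V (r • (x : EuclideanSpace ℝ (Fin d))) (basisTuple α)| ≤ ε := by
    intro α hα
    have hB' : Bornology.IsBounded (univ : Set (ball (0 : EuclideanSpace ℝ (Fin d)) 1)) := by
      refine (Metric.isBounded_iff_subset_closedBall ⟨0, by simp⟩).2 ⟨1, fun x _ => ?_⟩
      have := mem_ball.1 x.2
      rw [mem_closedBall, Subtype.dist_eq]
      exact this.le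
    have huc := uniformContinuousOn_univ.1 (hu2 α hα univ hB')
    obtain ⟨M, hM0, hM⟩ := bounded_of_uniformContinuous_ball huc
    obtain ⟨δ, hδ0, hδ⟩ := Metric.uniformContinuous_iff.1 huc (ε / 2) (by positivity)
    have t1 : ∀ᶠ r in nhdsWithin (1 : ℝ) (Ioo 0 1), 1 - r < δ := by
      refine Filter.Eventually.filter_mono nhdsWithin_le_nhds ?_
      have : Filter.Tendsto (fun r : ℝ => 1 - r) (nhds 1) (nhds (1 - 1)) :=
        (continuous_const.sub continuous_id).tendsto _
      exact this.eventually_lt_const (by simpa using hδ0)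
    have t2 : ∀ᶠ r in nhdsWithin (1 : ℝ) (Ioo 0 1), (1 - r ^ (∑ i, α i)) * M < ε / 2 := by
      refine Filter.Eventually.filter_mono nhdsWithin_le_nhds ?_
      have : Filter.Tendsto (fun r : ℝ => (1 - r ^ (∑ i, α i)) * M) (nhds 1)
          (nhds ((1 - 1 ^ (∑ i, α i)) * M)) :=
        Continuous.tendsto (by fun_prop) _
      exact this.eventually_lt_const (by simpa using hε)
    filter_upwards [t1, t2, self_mem_nhdsWithin] with r h1 h2 hr x
    have e : iteratedFDeriv ℝ (∑ i, α i) V (r • (x : EuclideanSpace ℝ (Fin d))) (basisTuple α) =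
        multiDeriv (ball 0 1) α u ⟨r • (x : EuclideanSpace ℝ (Fin d)), hrx r hr x⟩ := rfl
    rw [e]
    have hd : dist x ⟨r • (x : EuclideanSpace ℝ (Fin d)), hrx r hr x⟩ < δ := by
      rw [Subtype.dist_eq, dist_eq_norm]
      have h3 : (x : EuclideanSpace ℝ (Fin d)) - r • (x : EuclideanSpace ℝ (Fin d)) =
        (1 - r) • (x : EuclideanSpace ℝ (Fin d)) := by rw [sub_smul, one_smul]
      rw [h3, norm_smul, Real.norm_eq_abs, abs_of_pos (by linarith [hr.2])]
      have := mem_ball_zero_iff.1 x.2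
      nlinarith [hr.2]
    have h4 := hδ hd
    rw [Real.dist_eq] at h4
    have h5 := hM ⟨r • (x : EuclideanSpace ℝ (Fin d)), hrx r hr x⟩
    set a := multiDeriv (ball 0 1) α u x
    set b := multiDeriv (ball 0 1) α u ⟨r • (x : EuclideanSpace ℝ (Fin d)), hrx r hr x⟩
    have h6 : 0 ≤ 1 - r ^ (∑ i, α i) := by
      linarith [pow_le_one₀ hr.1.le hr.2.le (n := ∑ i, α i)]
    calc |a - r ^ (∑ i, α i) * b| = |(a - b) + (1 - r ^ (∑ i, α i)) * b| := by ring_nf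
      _ ≤ |a - b| + (1 - r ^ (∑ i, α i)) * |b| := by
        refine (abs_add_le _ _).trans_eq ?_
        rw [abs_mul, abs_of_nonneg h6]
      _ ≤ ε := by linarith [mul_le_mul_of_nonneg_left h5 h6]
  have hne : (nhdsWithin (1 : ℝ) (Ioo 0 1)).NeBot := right_nhdsWithin_Ioo_neBot one_pos
  -- Only finitely many multi-indices occur, so one `r` serves them all.
  have hall : ∀ᶠ r in nhdsWithin (1 : ℝ) (Ioo 0 1),
      ∀ α ∈ (Fintype.piFinset fun _ : Fin d => Finset.range (k + 1)), ∑ i, α i ≤ k → ∀ x : ball (0 : EuclideanSpace ℝ (Fin d)) 1,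
        |multiDeriv (ball 0 1) α u x - r ^ (∑ i, α i) *
        iteratedFDeriv ℝ (∑ i, α i) V (r • (x : EuclideanSpace ℝ (Fin d))) (basisTuple α)| ≤ ε := by
    refine (Filter.eventually_all_finset _).2 fun α _ => ?_
    by_cases h : ∑ i, α i ≤ k
    · filter_upwards [key α h] with r hr _ using hr
    · exact Filter.Eventually.of_forall fun r h' => absurd h' h
  obtain ⟨r, hr, hr01⟩ := (hall.and self_mem_nhdsWithin).exists
  have hr1 : 1 < 1 / r := (one_lt_div hr01.1).2 hr01.2
  -- The cutoff is one on the closed unit ball, and its support radius is the midpoint of `1` and `1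
  -- / r`, inside the ball where the dilate is `C^k`.
  let χ : ContDiffBump (0 : EuclideanSpace ℝ (Fin d)) :=
    ⟨1, (1 + 1 / r) / 2, one_pos, by linarith⟩
  refine ⟨fun x => χ x * V (r • x), χ.hasCompactSupport.mul_right, ?_, fun α hα x => ?_⟩
  · refine contDiff_bump_mul (isOpen_ball (x := 0) (ε := 1 / r)) (by exact_mod_cast χ.contDiff (n := k))
      (hu1.comp (contDiff_const_smul r).contDiffOn fun x hx => ?_) ?_
    · rw [mem_ball_zero_iff, norm_smul, Real.norm_eq_abs, abs_of_pos hr01.1]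
      have := mem_ball_zero_iff.1 hx
      rwa [lt_div_iff₀' hr01.1] at this
    · rw [χ.tsupport_eq]
      exact closedBall_subset_ball (by change (1 + 1 / r) / 2 < _; linarith)
  · have hloc : (fun x => χ x * V (r • x)) =ᶠ[nhds (x : EuclideanSpace ℝ (Fin d))]
        fun x => V (r • x) := by
      filter_upwards [isOpen_ball.mem_nhds x.2] with y hy
      rw [χ.one_of_mem_closedBall (ball_subset_closedBall hy), one_mul]
    rw [(hloc.iteratedFDeriv ℝ _).eq_of_nhds, iteratedFDeriv_comp_smul_of_ne_zero V hr01.1.ne']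
    rw [_root_.smul_apply, smul_eq_mul]
    refine hr α (Fintype.mem_piFinset.2 fun i => ?_) hα x
    rw [Finset.mem_range]
    have := Finset.single_le_sum (f := α) (fun _ _ => Nat.zero_le _) (Finset.mem_univ i)
    omega

end MultiDeriv

/-! ### Potentials of shell densities and their integration by parts identities -/

section Riesz

variable {d : ℕ}

/-- The densities of the potentials in `rieszSpace`: smooth functions with compact support in the
shell `B₄ ∖ closure B₃`. -/
structure IsShellTest (g : EuclideanSpace ℝ (Fin d) → ℝ) : Prop where
  contDiff : ContDiff ℝ (⊤ : ℕ∞) g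
  hasCompactSupport : HasCompactSupport g
  tsupport_subset : tsupport g ⊆ ball 0 4 \ closure (ball 0 3)

namespace IsShellTest

theorem zero : IsShellTest (0 : EuclideanSpace ℝ (Fin d) → ℝ) :=
  ⟨contDiff_const, HasCompactSupport.zero, by simp [tsupport]⟩

theorem add {g h : EuclideanSpace ℝ (Fin d) → ℝ} (hg : IsShellTest g) (hh : IsShellTest h) :
    IsShellTest (g + h) :=
  ⟨hg.contDiff.add hh.contDiff, hg.hasCompactSupport.add hh.hasCompactSupport,
    (tsupport_add g h).trans (union_subset hg.tsupport_subset hh.tsupport_subset)⟩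

theorem mul_left {g a : EuclideanSpace ℝ (Fin d) → ℝ} (hg : IsShellTest g)
    (ha : ContDiff ℝ (⊤ : ℕ∞) a) : IsShellTest fun y => a y * g y :=
  ⟨ha.mul hg.contDiff, hg.hasCompactSupport.mul_left,
    (tsupport_mul_subset_right (f := a)).trans hg.tsupport_subset⟩

theorem smul {g : EuclideanSpace ℝ (Fin d) → ℝ} (hg : IsShellTest g) (c : ℝ) :
    IsShellTest (c • g) :=
  hg.mul_left (a := fun _ => c) contDiff_const

theorem coord_mul {g : EuclideanSpace ℝ (Fin d) → ℝ} (hg : IsShellTest g) (i : Fin d) :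
    IsShellTest fun y => y i * g y :=
  hg.mul_left (a := fun y => y i) (contDiff_euclidean.1 contDiff_id i)

theorem fderiv_apply {g : EuclideanSpace ℝ (Fin d) → ℝ} (hg : IsShellTest g)
    (v : EuclideanSpace ℝ (Fin d)) : IsShellTest fun y => fderiv ℝ g y v :=
  ⟨hg.contDiff.fderiv_right (m := (⊤ : ℕ∞)) (by simp) |>.clm_apply contDiff_const,
    hg.hasCompactSupport.fderiv_apply ℝ v,
    (tsupport_fderiv_apply_subset ℝ v).trans hg.tsupport_subset⟩

theorem norm_mem {g : EuclideanSpace ℝ (Fin d) → ℝ} (hg : IsShellTest g)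
    {x y : EuclideanSpace ℝ (Fin d)} (hx : x ∈ ball (0 : EuclideanSpace ℝ (Fin d)) 1)
    (hy : y ∈ tsupport g) : ‖x - y‖ ∈ Icc (2 : ℝ) 5 := by
  obtain ⟨h1, h2⟩ := hg.tsupport_subset hy
  rw [closure_ball _ (by norm_num), mem_closedBall_zero_iff] at h2
  rw [mem_ball_zero_iff] at h1 hx
  constructor
  · linarith [norm_sub_norm_le y x, norm_sub_rev y x]
  · linarith [norm_sub_le x y]

end IsShellTest

/-- Truncating at `‖z‖ = 1` removes the singularity of the kernel, which need not be locally
integrable for very negative `γ`. Nothing is lost, since only `‖z‖ ≥ 2` is used. -/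
theorem continuous_max_norm_rpow (γ : ℝ) :
    Continuous fun z : EuclideanSpace ℝ (Fin d) => (max ‖z‖ 1) ^ γ :=
  Continuous.rpow_const (by fun_prop) fun z => Or.inl (by positivity)

namespace IsShellTest

theorem rieszKernel_mul_eq {g : EuclideanSpace ℝ (Fin d) → ℝ} (hg : IsShellTest g) (γ : ℝ)
    {x : EuclideanSpace ℝ (Fin d)} (hx : x ∈ ball (0 : EuclideanSpace ℝ (Fin d)) 1)
    (y : EuclideanSpace ℝ (Fin d)) :
    rieszKernel γ (x - y) * g y = (max ‖x - y‖ 1) ^ γ * g y := by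
  by_cases hy : y ∈ tsupport g
  · rw [rieszKernel, max_eq_left (by linarith [(hg.norm_mem hx hy).1])]
  · simp [image_eq_zero_of_notMem_tsupport hy]

theorem integrable {g : EuclideanSpace ℝ (Fin d) → ℝ} (hg : IsShellTest g) (γ : ℝ)
    {x : EuclideanSpace ℝ (Fin d)} (hx : x ∈ ball (0 : EuclideanSpace ℝ (Fin d)) 1) :
    Integrable fun y => rieszKernel γ (x - y) * g y := by
  simp only [hg.rieszKernel_mul_eq γ hx]
  exact (((continuous_max_norm_rpow γ).comp (continuous_const.sub continuous_id)).mul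
    hg.contDiff.continuous).integrable_of_hasCompactSupport hg.hasCompactSupport.mul_left

theorem rieszPotential_eq_convolution {g : EuclideanSpace ℝ (Fin d) → ℝ} (hg : IsShellTest g)
    (γ : ℝ) {x : EuclideanSpace ℝ (Fin d)} (hx : x ∈ ball (0 : EuclideanSpace ℝ (Fin d)) 1) :
    rieszPotential γ g x = ((fun z => (max ‖z‖ 1) ^ γ) ⋆[lsmul ℝ ℝ, volume] g) x := by
  simp only [rieszPotential, hg.rieszKernel_mul_eq γ hx, convolution_eq_swap, lsmul_apply,
    smul_eq_mul]

theorem rieszPotential_add {g h : EuclideanSpace ℝ (Fin d) → ℝ} (hg : IsShellTest g)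
    (hh : IsShellTest h) (γ : ℝ) {x : EuclideanSpace ℝ (Fin d)}
    (hx : x ∈ ball (0 : EuclideanSpace ℝ (Fin d)) 1) :
    rieszPotential γ (g + h) x = rieszPotential γ g x + rieszPotential γ h x := by
  simp only [rieszPotential]
  rw [← integral_add (hg.integrable γ hx) (hh.integrable γ hx)]
  simp only [Pi.add_apply, mul_add]

end IsShellTest

theorem rieszPotential_smul (c γ : ℝ) (g : EuclideanSpace ℝ (Fin d) → ℝ)
    (x : EuclideanSpace ℝ (Fin d)) :
    rieszPotential γ (c • g) x = c * rieszPotential γ g x := by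
  simp only [rieszPotential]
  rw [← integral_const_mul]
  congr 1 with y
  simp only [Pi.smul_apply, smul_eq_mul]
  ring

theorem hasLineDerivAt_norm_sub_rpow (γ : ℝ) {x y : EuclideanSpace ℝ (Fin d)} (h : x ≠ y)
    (i : Fin d) :
    HasLineDerivAt ℝ (fun y => ‖x - y‖ ^ γ) (-γ * (x i - y i) * ‖x - y‖ ^ (γ - 2)) y
      (EuclideanSpace.single i (1 : ℝ)) := by
  -- The squared norm is differentiable everywhere, so the power is taken of it.
  have hrw : ∀ (z : EuclideanSpace ℝ (Fin d)) (p : ℝ), ‖z‖ ^ p = (‖z‖ ^ 2) ^ (p / 2) := by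
    intro z p
    rw [← Real.rpow_natCast, ← Real.rpow_mul (norm_nonneg _)]
    congr 1
    push_cast
    ring
  have hpos : ‖x - y‖ ^ 2 ≠ 0 := by
    have := norm_pos_iff.2 (sub_ne_zero.2 h)
    positivity
  unfold HasLineDerivAt
  have h1 : HasDerivAt (fun t : ℝ => x - (y + t • EuclideanSpace.single i (1 : ℝ)))
      (-EuclideanSpace.single i (1 : ℝ)) 0 := by
    have := (((hasDerivAt_id (0 : ℝ)).smul_const
      (EuclideanSpace.single i (1 : ℝ))).const_add y).const_sub x
    simpa using this
  have h2 := h1.norm_sq.rpow_const (p := γ / 2) (Or.inl (by simpa using hpos))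
  simp only [← hrw] at h2
  refine h2.congr_deriv ?_
  rw [hrw (x - y) (γ - 2)]
  simp only [zero_smul, add_zero, inner_neg_right, EuclideanSpace.inner_single_right]
  rw [show (γ - 2) / 2 = γ / 2 - 1 by ring]
  simp
  ring

/-- Integration by parts in `y`; the factor `x i - y i` from the derivative of the kernel is then
split. -/
theorem rieszPotential_fderiv {g : EuclideanSpace ℝ (Fin d) → ℝ} (hg : IsShellTest g)
    (γ : ℝ) (i : Fin d) {x : EuclideanSpace ℝ (Fin d)}
    (hx : x ∈ ball (0 : EuclideanSpace ℝ (Fin d)) 1) :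
    rieszPotential γ (fun y => fderiv ℝ g y (EuclideanSpace.single i 1)) x =
      γ * (x i * rieszPotential (γ - 2) g x - rieszPotential (γ - 2) (fun y => y i * g y) x) := by
  have hne : ∀ y ∈ tsupport g, x ≠ y := by
    rintro y hy rfl
    have := (hg.norm_mem hx hy).1
    norm_num at this
  have hf'g : (fun y => (-γ * (x i - y i) * ‖x - y‖ ^ (γ - 2)) * g y) = fun y =>
      -γ * (x i * (rieszKernel (γ - 2) (x - y) * g y) -
        rieszKernel (γ - 2) (x - y) * (y i * g y)) := by
    ext y
    simp only [rieszKernel]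
    ring
  have i1 := (hg.integrable (γ - 2) hx).const_mul (x i)
  have i2 := (hg.coord_mul i).integrable (γ - 2) hx
  have key := integral_bilinear_hasLineDerivAt_right_eq_neg_left_of_integrable (μ := volume)
    (B := ContinuousLinearMap.mul ℝ ℝ) (f := fun y => ‖x - y‖ ^ γ) (g := g)
    (f' := fun y => -γ * (x i - y i) * ‖x - y‖ ^ (γ - 2))
    (g' := fun y => fderiv ℝ g y (EuclideanSpace.single i 1)) (v := EuclideanSpace.single i 1)
    (by simp only [mul_apply']; rw [hf'g]; exact (i1.sub i2).const_mul _)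
    ((hg.fderiv_apply _).integrable γ hx) (hg.integrable γ hx)
    (fun y hy => hasLineDerivAt_norm_sub_rpow γ (hne y hy) i)
    (fun y _ => ((hg.contDiff.differentiable (by simp)) y).hasFDerivAt.hasLineDerivAt _)
  simp only [mul_apply', hf'g] at key
  rw [integral_const_mul, integral_sub i1 i2, integral_const_mul] at key
  simp only [rieszPotential]
  refine key.trans ?_
  ring

/-- Each summand is the integral of `(x i - y i)²` against the kernel, and these squares add up to
`|x - y|²`. The expanded form is the one produced by two uses of `rieszPotential_fderiv`. -/
theorem sum_coord_mul_rieszPotential {g : EuclideanSpace ℝ (Fin d) → ℝ} (hg : IsShellTest g)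
    (γ : ℝ) {x : EuclideanSpace ℝ (Fin d)} (hx : x ∈ ball (0 : EuclideanSpace ℝ (Fin d)) 1) :
    ∑ i, (x i * (x i * rieszPotential (γ - 2) g x - rieszPotential (γ - 2) (fun y => y i * g y) x) -
      (x i * rieszPotential (γ - 2) (fun y => y i * g y) x -
        rieszPotential (γ - 2) (fun y => y i * (y i * g y)) x)) = rieszPotential γ g x := by
  have i0 := hg.integrable (γ - 2) hx
  have i1 := fun i => (hg.coord_mul i).integrable (γ - 2) hx
  have i2 := fun i => ((hg.coord_mul i).coord_mul i).integrable (γ - 2) hx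
  have e : ∀ i, (x i * (x i * rieszPotential (γ - 2) g x -
      rieszPotential (γ - 2) (fun y => y i * g y) x) -
      (x i * rieszPotential (γ - 2) (fun y => y i * g y) x -
        rieszPotential (γ - 2) (fun y => y i * (y i * g y)) x)) =
      ∫ y, (x i - y i) ^ 2 * (rieszKernel (γ - 2) (x - y) * g y) := by
    intro i
    simp only [rieszPotential]
    rw [← integral_const_mul, ← integral_sub (i0.const_mul _) (i1 i), ← integral_const_mul,
      ← integral_const_mul, ← integral_sub ((i1 i).const_mul _) (i2 i)]
    refine (integral_sub (((i0.const_mul _).sub (i1 i)).const_mul _)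
      (((i1 i).const_mul _).sub (i2 i))).symm.trans ?_
    congr 1 with y
    simp only [Pi.sub_apply]
    ring
  have hi : ∀ i, Integrable fun y : EuclideanSpace ℝ (Fin d) =>
      (x i - y i) ^ 2 * (rieszKernel (γ - 2) (x - y) * g y) := by
    intro i
    refine ((((i0.const_mul (x i)).sub (i1 i)).const_mul (x i)).sub
      (((i1 i).const_mul (x i)).sub (i2 i))).congr (Filter.Eventually.of_forall fun y => ?_)
    simp only [Pi.sub_apply]
    ring
  rw [Finset.sum_congr rfl fun i _ => e i, ← integral_finsetSum _ fun i _ => hi i]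
  simp only [rieszPotential, ← Finset.sum_mul]
  congr 1 with y
  by_cases hy : y ∈ tsupport g
  · have h2 := (hg.norm_mem hx hy).1
    have h3 := EuclideanSpace.real_norm_sq_eq (x - y)
    simp only [PiLp.sub_apply] at h3
    rw [← h3, rieszKernel, rieszKernel, ← mul_assoc, ← Real.rpow_natCast,
      ← Real.rpow_add (by linarith)]
    congr 2
    push_cast
    ring
  · simp [image_eq_zero_of_notMem_tsupport hy]

/-- This is `K_γ (Δ g)`, with the Laplacian moved to the kernel. The second derivatives contribute
`γ (γ - 2)`, and the commutators of `∂_i` with `y_i` contribute `γ d`. -/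
theorem sum_rieszPotential_fderiv_fderiv {g : EuclideanSpace ℝ (Fin d) → ℝ} (hg : IsShellTest g)
    (γ : ℝ) {x : EuclideanSpace ℝ (Fin d)} (hx : x ∈ ball (0 : EuclideanSpace ℝ (Fin d)) 1) :
    ∑ i, rieszPotential γ (fun y => fderiv ℝ (fun z => fderiv ℝ g z (EuclideanSpace.single i 1)) y
      (EuclideanSpace.single i 1)) x = γ * (γ - 2 + d) * rieszPotential (γ - 2) g x := by
  -- Product rule: `y_i ∂_i g = ∂_i (y_i g) - g`.
  have e : ∀ i, rieszPotential (γ - 2)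
      (fun y => y i * fderiv ℝ g y (EuclideanSpace.single i 1)) x =
      rieszPotential (γ - 2)
        (fun y => fderiv ℝ (fun z => z i * g z) y (EuclideanSpace.single i 1)) x -
      rieszPotential (γ - 2) g x := by
    intro i
    rw [eq_sub_iff_add_eq, ← ((hg.fderiv_apply _).coord_mul i).rieszPotential_add hg _ hx]
    congr 1 with y
    have h1 : HasFDerivAt (fun z : EuclideanSpace ℝ (Fin d) => z i)
        (EuclideanSpace.proj i : EuclideanSpace ℝ (Fin d) →L[ℝ] ℝ) y :=
      (EuclideanSpace.proj i : EuclideanSpace ℝ (Fin d) →L[ℝ] ℝ).hasFDerivAt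
    have h2 := (hg.contDiff.differentiable (by simp) y).hasFDerivAt
    have h3 : HasFDerivAt (fun z : EuclideanSpace ℝ (Fin d) => z i * g z) _ y := h1.mul h2
    rw [h3.fderiv]
    simp
  have e2 : ∀ i, rieszPotential γ (fun y => fderiv ℝ (fun z => fderiv ℝ g z
      (EuclideanSpace.single i 1)) y (EuclideanSpace.single i 1)) x =
      γ * (γ - 2) * (x i * (x i * rieszPotential (γ - 2 - 2) g x -
        rieszPotential (γ - 2 - 2) (fun y => y i * g y) x) -
      (x i * rieszPotential (γ - 2 - 2) (fun y => y i * g y) x -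
        rieszPotential (γ - 2 - 2) (fun y => y i * (y i * g y)) x)) +
      γ * rieszPotential (γ - 2) g x := by
    intro i
    rw [rieszPotential_fderiv (hg.fderiv_apply _) γ i hx, e,
      rieszPotential_fderiv hg _ i hx, rieszPotential_fderiv (hg.coord_mul i) _ i hx]
    ring
  rw [Finset.sum_congr rfl fun i _ => e2 i, Finset.sum_add_distrib, ← Finset.mul_sum,
    sum_coord_mul_rieszPotential hg (γ - 2) hx]
  simp
  ring

end Riesz

/-! ### Multipliers, and approximation of polynomials by potentials -/

section RieszSpace

variable {d : ℕ} {s : ℝ}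

theorem mem_rieszSpace_iff {f : ball (0 : EuclideanSpace ℝ (Fin d)) 1 → ℝ} :
    f ∈ rieszSpace d s ↔
      ∃ g : EuclideanSpace ℝ (Fin d) → ℝ, IsShellTest g ∧ ∀ x : ball (0 : EuclideanSpace ℝ (Fin d)) 1,
        f x = rieszPotential (2 * s - d) g x :=
  ⟨fun ⟨g, h1, h2, h3, h4⟩ => ⟨g, ⟨h1, h2, h3⟩, h4⟩,
    fun ⟨g, ⟨h1, h2, h3⟩, h4⟩ => ⟨g, h1, h2, h3, h4⟩⟩

variable (d s) in
/-- The linear space of all restrictions to the unit ball of the potentials in `rieszSpace`. -/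
noncomputable def rieszSubmodule : Submodule ℝ (ball (0 : EuclideanSpace ℝ (Fin d)) 1 → ℝ) where
  carrier := rieszSpace d s
  add_mem' := by
    intro a b ha hb
    obtain ⟨g, hg, hga⟩ := mem_rieszSpace_iff.1 ha
    obtain ⟨h, hh, hhb⟩ := mem_rieszSpace_iff.1 hb
    exact mem_rieszSpace_iff.2 ⟨g + h, hg.add hh, fun x => by
      rw [hg.rieszPotential_add hh _ x.2, Pi.add_apply, hga, hhb]⟩
  zero_mem' := mem_rieszSpace_iff.2 ⟨0, .zero, fun x => by simp [rieszPotential]⟩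
  smul_mem' := by
    intro c a ha
    obtain ⟨g, hg, hga⟩ := mem_rieszSpace_iff.1 ha
    exact mem_rieszSpace_iff.2 ⟨c • g, hg.smul c, fun x => by
      rw [rieszPotential_smul, Pi.smul_apply, hga, smul_eq_mul]⟩

/-- The product of `φ` with every potential of order `γ` is the potential of order `2s - d` of some
density. -/
def IsRieszMultiplier (s γ : ℝ) (φ : EuclideanSpace ℝ (Fin d) → ℝ) : Prop :=
  ∀ g : EuclideanSpace ℝ (Fin d) → ℝ, IsShellTest g →
    (fun x : ball (0 : EuclideanSpace ℝ (Fin d)) 1 => φ x * rieszPotential γ g x) ∈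
      rieszSubmodule d s

theorem IsRieszMultiplier.sub_two {γ : ℝ} {φ : EuclideanSpace ℝ (Fin d) → ℝ}
    (h : IsRieszMultiplier s γ φ) (hγ : γ * (γ - 2 + d) ≠ 0) :
    IsRieszMultiplier s (γ - 2) φ := by
  intro g hg
  have h1 := (rieszSubmodule d s).smul_mem (γ * (γ - 2 + d))⁻¹
    ((rieszSubmodule d s).sum_mem (t := Finset.univ) fun i _ =>
      h _ ((hg.fderiv_apply (EuclideanSpace.single i 1)).fderiv_apply (EuclideanSpace.single i 1)))
  convert h1 using 1
  ext x
  simp only [Pi.smul_apply, Finset.sum_apply, ← Finset.mul_sum, smul_eq_mul]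
  rw [sum_rieszPotential_fderiv_fderiv hg γ x.2, mul_left_comm (φ x), inv_mul_cancel_left₀ hγ]

/-- Solve `rieszPotential_fderiv` for `x i * K_(γ-2) g`: the remaining terms are `K_γ (∂_i g) / γ`
and `K_(γ-2) (y_i g)`, which the two multiplier hypotheses cover. -/
theorem IsRieszMultiplier.mul_coord {γ : ℝ} {φ : EuclideanSpace ℝ (Fin d) → ℝ}
    (h : IsRieszMultiplier s γ φ) (h' : IsRieszMultiplier s (γ - 2) φ) (hγ : γ ≠ 0) (i : Fin d) :
    IsRieszMultiplier s (γ - 2) fun x => φ x * x i := by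
  intro g hg
  have h1 := (rieszSubmodule d s).add_mem ((rieszSubmodule d s).smul_mem γ⁻¹
    (h _ (hg.fderiv_apply (EuclideanSpace.single i 1)))) (h' _ (hg.coord_mul i))
  convert h1 using 1
  ext x
  simp only [Pi.smul_apply, Pi.add_apply, smul_eq_mul]
  rw [rieszPotential_fderiv hg γ i x.2]
  field_simp
  ring

theorem isRieszMultiplier_one (hs1 : s < 1) (hd : 2 * s < (d : ℝ)) (m : ℕ) :
    IsRieszMultiplier (d := d) s (2 * s - d - 2 * m) fun _ => 1 := by
  induction m with
  | zero =>
    intro g hg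
    exact mem_rieszSpace_iff.2 ⟨g, hg, fun x => by simp⟩
  | succ m ih =>
    have hm : (0 : ℝ) ≤ m := m.cast_nonneg
    -- For `γ = 2s - d - 2m` both factors are negative: `γ` because `2s < d`, and `γ - 2 + d = 2s -
    -- 2 - 2m` because `s < 1`.
    have := ih.sub_two (mul_ne_zero (by linarith) (by linarith))
    convert this using 1
    push_cast
    ring

/-- Each multiplication by a coordinate costs one step in `m`. All `m ≥ N` are needed, so that sums
can share an exponent and a whole range of powers is available later. -/
theorem exists_isRieszMultiplier_eval (hs1 : s < 1) (hd : 2 * s < (d : ℝ))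
    (p : MvPolynomial (Fin d) ℝ) :
    ∃ N : ℕ, ∀ m ≥ N, IsRieszMultiplier (d := d) s (2 * s - d - 2 * m)
      fun x => MvPolynomial.eval x p := by
  induction p using MvPolynomial.induction_on with
  | C a =>
    refine ⟨0, fun m _ g hg => ?_⟩
    convert (rieszSubmodule d s).smul_mem a (isRieszMultiplier_one hs1 hd m g hg) using 1
    ext x
    simp
  | add p q hp hq =>
    obtain ⟨N, hN⟩ := hp
    obtain ⟨M, hM⟩ := hq
    refine ⟨max N M, fun m hm g hg => ?_⟩
    convert (rieszSubmodule d s).add_mem (hN m (le_of_max_le_left hm) g hg)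
      (hM m (le_of_max_le_right hm) g hg) using 1
    ext x
    simp [add_mul]
  | mul_X p i hp =>
    obtain ⟨N, hN⟩ := hp
    refine ⟨N + 1, fun m hm => ?_⟩
    obtain ⟨m, rfl⟩ : ∃ n, m = n + 1 := ⟨m - 1, by omega⟩
    have e : 2 * s - d - 2 * ((m + 1 : ℕ) : ℝ) = 2 * s - d - 2 * m - 2 := by
      push_cast
      ring
    have hm0 : (0 : ℝ) ≤ m := m.cast_nonneg
    rw [e]
    simp only [map_mul, MvPolynomial.eval_X]
    exact (hN m (by omega)).mul_coord (e ▸ hN (m + 1) (by omega)) (by linarith) i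

/-- There is a shell density of total mass one. -/
theorem exists_isShellTest_integral_eq_one (hd : 0 < d) :
    ∃ g : EuclideanSpace ℝ (Fin d) → ℝ, IsShellTest g ∧ ∫ y, g y = 1 := by
  -- The centre lies midway in the shell, and a ball of radius `1 / 4` around it stays inside.
  let c : EuclideanSpace ℝ (Fin d) := EuclideanSpace.single ⟨0, hd⟩ (7 / 2)
  have hc : ‖c‖ = 7 / 2 := by simp [c]
  let φ : ContDiffBump c := ⟨1 / 8, 1 / 4, by norm_num, by norm_num⟩
  refine ⟨φ.normed volume, ⟨φ.contDiff_normed, φ.hasCompactSupport_normed, ?_⟩,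
    φ.integral_normed⟩
  rw [φ.tsupport_normed_eq]
  intro y hy
  have hy' : ‖y - c‖ ≤ 1 / 4 := mem_closedBall_iff_norm.1 hy
  rw [closure_ball _ (by norm_num)]
  constructor
  · rw [mem_ball_zero_iff]
    linarith [norm_sub_norm_le y c]
  · rw [mem_closedBall_zero_iff]
    linarith [norm_sub_norm_le c y, norm_sub_rev c y]

/-- Some linear combination of the powers `ρ^(γ - 2m)` is uniformly close to one on `[2, 5]`. -/
theorem exists_polynomial_rpow_near {γ : ℝ} (hγ : γ ≤ 0) {ε : ℝ} (hε : 0 < ε) :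
    ∃ Q : Polynomial ℝ, ∀ ρ ∈ Icc (2 : ℝ) 5, |1 - ρ ^ γ * Q.eval ((ρ ^ 2)⁻¹)| ≤ ε := by
  -- With `t = ρ⁻²` the interval `[2, 5]` becomes `[1/25, 1/4]`, and `t^(γ/2) = ρ^(-γ)` is the
  -- function to approximate. Multiplying back by `ρ^γ ≤ 1` does not enlarge the error.
  have hcont : ContinuousOn (fun r : ℝ => r ^ (γ / 2)) (Icc (1 / 25) (1 / 4)) :=
    continuousOn_id.rpow_const fun x hx => Or.inl (by
      have := hx.1
      simp only [id]
      intro h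
      norm_num [h] at this)
  obtain ⟨Q, hQ⟩ := exists_polynomial_near_of_continuousOn _ _ _ hcont ε hε
  refine ⟨Q, fun ρ hρ => ?_⟩
  have h0 : 0 < ρ := by linarith [hρ.1]
  have h4 : (4 : ℝ) ≤ ρ ^ 2 := by nlinarith [hρ.1]
  have h25 : ρ ^ 2 ≤ 25 := by nlinarith [hρ.1, hρ.2]
  have hmem : (ρ ^ 2)⁻¹ ∈ Icc (1 / 25 : ℝ) (1 / 4) := by
    rw [← one_div]
    exact ⟨one_div_le_one_div_of_le (by positivity) h25,
      one_div_le_one_div_of_le (by norm_num) h4⟩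
  have h1 := hQ _ hmem
  have h2 : ((ρ ^ 2)⁻¹) ^ (γ / 2) = (ρ ^ γ)⁻¹ := by
    rw [Real.inv_rpow (by positivity), ← Real.rpow_natCast, ← Real.rpow_mul h0.le]
    congr 2
    push_cast
    ring
  rw [h2] at h1
  have hp : 0 < ρ ^ γ := Real.rpow_pos_of_pos h0 _
  have hle : ρ ^ γ ≤ 1 := Real.rpow_le_one_of_one_le_of_nonpos (by linarith [hρ.1]) hγ
  have h3 : 1 - ρ ^ γ * Q.eval ((ρ ^ 2)⁻¹) = -(ρ ^ γ * (Q.eval ((ρ ^ 2)⁻¹) - (ρ ^ γ)⁻¹)) := by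
    field_simp
    ring
  rw [h3, abs_neg, abs_mul, abs_of_pos hp]
  nlinarith [abs_nonneg (Q.eval ((ρ ^ 2)⁻¹) - (ρ ^ γ)⁻¹)]

theorem exists_bound_iteratedFDeriv_eval (p : MvPolynomial (Fin d) ℝ) (k : ℕ) :
    ∃ M : ℝ, 0 ≤ M ∧ ∀ j ≤ k, ∀ x ∈ ball (0 : EuclideanSpace ℝ (Fin d)) 1,
      ‖iteratedFDeriv ℝ j (fun x : EuclideanSpace ℝ (Fin d) => MvPolynomial.eval x p) x‖ ≤ M := by
  have h : ∀ j : ℕ, ∃ M : ℝ, ∀ x ∈ closedBall (0 : EuclideanSpace ℝ (Fin d)) 1,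
      ‖iteratedFDeriv ℝ j (fun x : EuclideanSpace ℝ (Fin d) => MvPolynomial.eval x p) x‖ ≤ M :=
    fun j => (isCompact_closedBall _ _).exists_bound_of_continuousOn
      ((contDiff_mvPolynomial_eval (n := j) p).continuous_iteratedFDeriv le_rfl).continuousOn
  choose M hM using h
  refine ⟨∑ j ∈ Finset.range (k + 1), |M j|, Finset.sum_nonneg fun _ _ => abs_nonneg _,
    fun j hj x hx => ?_⟩
  exact ((hM j x (ball_subset_closedBall hx)).trans (le_abs_self _)).trans
    (Finset.single_le_sum (f := fun j => |M j|) (fun _ _ => abs_nonneg _) (by simp; omega))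

theorem norm_iteratedFDeriv_mul_le_of_le {E : Type*} [NormedAddCommGroup E] [NormedSpace ℝ E]
    {f h : E → ℝ} {k : ℕ} (hf : ContDiff ℝ k f) (hh : ContDiff ℝ k h) {x : E} {A C : ℝ}
    (hA0 : 0 ≤ A) (hA : ∀ j ≤ k, ‖iteratedFDeriv ℝ j f x‖ ≤ A)
    (hC : ∀ j ≤ k, ‖iteratedFDeriv ℝ j h x‖ ≤ C) {j : ℕ} (hj : j ≤ k) :
    ‖iteratedFDeriv ℝ j (fun y => f y * h y) x‖ ≤ 2 ^ k * A * C := by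
  have hC0 : 0 ≤ C := (norm_nonneg _).trans (hC 0 (Nat.zero_le _))
  calc ‖iteratedFDeriv ℝ j (fun y => f y * h y) x‖
      ≤ ∑ i ∈ Finset.range (j + 1), (j.choose i : ℝ) * ‖iteratedFDeriv ℝ i f x‖ *
          ‖iteratedFDeriv ℝ (j - i) h x‖ :=
        norm_iteratedFDeriv_mul_le hf hh x (by exact_mod_cast hj)
    _ ≤ ∑ i ∈ Finset.range (j + 1), (j.choose i : ℝ) * A * C := by
        refine Finset.sum_le_sum fun i hi => ?_
        have hi' : i ≤ j := by simpa [Nat.lt_succ_iff] using hi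
        gcongr
        · exact hA i (hi'.trans hj)
        · exact hC _ (by omega)
    _ = 2 ^ j * A * C := by
        rw [← Finset.sum_mul, ← Finset.sum_mul]
        congr 2
        exact_mod_cast Nat.sum_range_choose j
    _ ≤ 2 ^ k * A * C := by
        gcongr
        norm_num

/-- On the unit ball, polynomials are approximated by elements of `rieszSpace`, together with their
derivatives of order at most `k`. -/
theorem exists_rieszSpace_near_eval (hs0 : 0 < s) (hs1 : s < 1) (hd : 2 * s < (d : ℝ)) (k : ℕ)
    (p : MvPolynomial (Fin d) ℝ) {ε : ℝ} (hε : 0 < ε) :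
    ∃ e : EuclideanSpace ℝ (Fin d) → ℝ, ContDiff ℝ k e ∧
      (∀ x ∈ ball (0 : EuclideanSpace ℝ (Fin d)) 1, ∀ j ≤ k, ‖iteratedFDeriv ℝ j e x‖ ≤ ε) ∧
      (fun x : ball (0 : EuclideanSpace ℝ (Fin d)) 1 => MvPolynomial.eval x.1 p - e x) ∈
        rieszSpace d s := by
  have hd0 : 0 < d := by
    rcases Nat.eq_zero_or_pos d with rfl | h
    · norm_num at hd; linarith
    · exact h
  obtain ⟨g, hg, hg1⟩ := exists_isShellTest_integral_eq_one hd0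
  obtain ⟨N, hN⟩ := exists_isRieszMultiplier_eval hs1 hd p
  obtain ⟨M, hM0, hM⟩ := exists_bound_iteratedFDeriv_eval p k
  set D : ℝ := ∑ j ∈ Finset.range (k + 1), ∫ y, ‖iteratedFDeriv ℝ j g y‖
  have hD0 : 0 ≤ D := Finset.sum_nonneg fun j _ => integral_nonneg fun _ => norm_nonneg _
  have hDj : ∀ j ≤ k, ∫ y, ‖iteratedFDeriv ℝ j g y‖ ≤ D := fun j hj =>
    Finset.single_le_sum (f := fun j => ∫ y, ‖iteratedFDeriv ℝ j g y‖)
      (fun j _ => integral_nonneg fun _ => norm_nonneg _) (by simp; omega)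
  set γ : ℝ := 2 * s - d - 2 * N with hγ
  have hN0 : (0 : ℝ) ≤ N := N.cast_nonneg
  -- Chosen so that the Leibniz bound `2 ^ k * M * (η * D)` is at most `ε`.
  set η : ℝ := ε / (2 ^ k * M * D + 1) with hη
  have hden : 0 < 2 ^ k * M * D + 1 :=
    add_pos_of_nonneg_of_pos (mul_nonneg (mul_nonneg (by positivity) hM0) hD0) one_pos
  have hη0 : 0 < η := div_pos hε hden
  obtain ⟨Q, hQ⟩ := exists_polynomial_rpow_near (γ := γ) (by linarith) hη0
  let r : EuclideanSpace ℝ (Fin d) → ℝ := fun z => max ‖z‖ 1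
  -- `H` is the defect of the kernel combination from one; the error function will be `p · (H ∗ g)`.
  let H : EuclideanSpace ℝ (Fin d) → ℝ := fun z => 1 - r z ^ γ * Q.eval ((r z ^ 2)⁻¹)
  have hr1 : ∀ z, 1 ≤ r z := fun z => le_max_right _ _
  have hrc : Continuous r := by fun_prop
  have hHc : Continuous H := by
    refine continuous_const.sub ((continuous_max_norm_rpow γ).mul (Q.continuous.comp ?_))
    exact (hrc.pow 2).inv₀ fun z => (pow_pos (one_pos.trans_le (hr1 z)) 2).ne'
  have hgk : ContDiff ℝ k g := hg.contDiff.of_le (by exact_mod_cast le_top)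
  have hEc : ContDiff ℝ k (H ⋆[lsmul ℝ ℝ, volume] g) := by
    exact_mod_cast hg.hasCompactSupport.contDiff_convolution_right (n := k) (lsmul ℝ ℝ)
      hHc.locallyIntegrable (by exact_mod_cast hgk)
  have hHb : ∀ x ∈ ball (0 : EuclideanSpace ℝ (Fin d)) 1, ∀ y ∈ tsupport g, |H (x - y)| ≤ η := by
    intro x hx y hy
    have h := hg.norm_mem hx hy
    have e : r (x - y) = ‖x - y‖ := max_eq_left (by linarith [h.1])
    simp only [H, e]
    exact hQ _ h
  refine ⟨fun x => MvPolynomial.eval x p * (H ⋆[lsmul ℝ ℝ, volume] g) x,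
    (contDiff_mvPolynomial_eval p).mul hEc, fun x hx j hj => ?_, ?_⟩
  · refine (norm_iteratedFDeriv_mul_le_of_le (contDiff_mvPolynomial_eval p) hEc hM0
      (fun j hj => hM j hj x hx) (C := η * D) (fun j hj => ?_) hj).trans ?_
    · exact (norm_iteratedFDeriv_convolution_lsmul_le hHc.locallyIntegrable hg.hasCompactSupport
        hgk hj (hHb x hx)).trans (mul_le_mul_of_nonneg_left (hDj j hj) hη0.le)
    · have : 2 ^ k * M * (η * D) = ε * (2 ^ k * M * D) / (2 ^ k * M * D + 1) := by
        rw [hη]; ring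
      rw [this, div_le_iff₀ hden]
      nlinarith
  · have hmem : (∑ i ∈ Finset.range (Q.natDegree + 1), Q.coeff i •
        fun x : ball (0 : EuclideanSpace ℝ (Fin d)) 1 => MvPolynomial.eval x.1 p *
          rieszPotential (2 * s - d - 2 * ((N + i : ℕ) : ℝ)) g x) ∈ rieszSubmodule d s :=
      Submodule.sum_mem _ fun i _ => Submodule.smul_mem _ _ (hN (N + i) (by omega) g hg)
    refine (congrArg (· ∈ rieszSubmodule d s) ?_).mpr hmem
    ext x
    simp only [Finset.sum_apply, Pi.smul_apply, smul_eq_mul]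
    -- The powers in `r ^ γ * Q (r⁻²)` have exponents `γ - 2i = 2s - d - 2(N + i)`, all in the range
    -- where `p` is a multiplier.
    have hker : ∀ y, H (x.1 - y) * g y = g y - ∑ i ∈ Finset.range (Q.natDegree + 1),
        Q.coeff i * (rieszKernel (2 * s - d - 2 * ((N + i : ℕ) : ℝ)) (x.1 - y) * g y) := by
      intro y
      simp only [hg.rieszKernel_mul_eq _ x.2]
      have hr0 : 0 < r (x.1 - y) := lt_of_lt_of_le one_pos (hr1 _)
      simp only [H, Polynomial.eval_eq_sum_range, sub_mul, one_mul, Finset.mul_sum, Finset.sum_mul]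
      congr 1
      refine Finset.sum_congr rfl fun i _ => ?_
      have e : max ‖x.1 - y‖ 1 ^ (2 * s - d - 2 * ((N + i : ℕ) : ℝ)) =
          r (x.1 - y) ^ γ * ((r (x.1 - y) ^ 2)⁻¹) ^ i := by
        rw [inv_pow, ← pow_mul, ← Real.rpow_natCast, ← Real.rpow_neg hr0.le, ← Real.rpow_add hr0]
        congr 1
        rw [hγ]
        push_cast
        ring
      rw [e]
      ring
    have hgi : Integrable g := hg.contDiff.continuous.integrable_of_hasCompactSupport
      hg.hasCompactSupport
    have hint : (H ⋆[lsmul ℝ ℝ, volume] g) x.1 = 1 - ∑ i ∈ Finset.range (Q.natDegree + 1),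
        Q.coeff i * rieszPotential (2 * s - d - 2 * ((N + i : ℕ) : ℝ)) g x.1 := by
      simp only [convolution_eq_swap, lsmul_apply, smul_eq_mul, hker]
      rw [integral_sub hgi (integrable_finsetSum _ fun i _ => (hg.integrable _ x.2).const_mul _),
        integral_finsetSum _ fun i _ => (hg.integrable _ x.2).const_mul _, hg1]
      simp only [integral_const_mul, rieszPotential]
    rw [hint, mul_sub, mul_one, sub_sub_cancel, Finset.mul_sum]
    exact Finset.sum_congr rfl fun i _ => by ring

end RieszSpace

/-! ### Linearity, regularity and density -/

theorem theorem2p1 (d : ℕ) (s : ℝ) (hs0 : 0 < s) (hs1 : s < 1) (hd : 2 * s < (d : ℝ)) (k : ℕ) :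
    (∃ V : Submodule ℝ (Metric.ball (0 : EuclideanSpace ℝ (Fin d)) 1 → ℝ),
      (V : Set (Metric.ball (0 : EuclideanSpace ℝ (Fin d)) 1 → ℝ)) = rieszSpace d s) ∧
    rieszSpace d s ⊆ CkClosure (Metric.ball 0 1) k ∧
    ∀ u ∈ CkClosure (Metric.ball (0 : EuclideanSpace ℝ (Fin d)) 1) k, ∀ ε : ℝ, 0 < ε →
      ∃ f ∈ rieszSpace d s, CkNorm (Metric.ball 0 1) k (u - f) < ENNReal.ofReal ε := by
  refine ⟨⟨rieszSubmodule d s, rfl⟩, fun f hf => ?_, fun u hu ε hε => ?_⟩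
  · obtain ⟨g, hg, hfg⟩ := mem_rieszSpace_iff.1 hf
    refine mem_CkClosure_of_contDiff isOpen_ball
      (fun x => (hfg x).trans (hg.rieszPotential_eq_convolution _ x.2)) ?_
    exact_mod_cast hg.hasCompactSupport.contDiff_convolution_right (n := k) (lsmul ℝ ℝ)
      (continuous_max_norm_rpow _).locallyIntegrable
      (hg.contDiff.of_le (by exact_mod_cast le_top))
  · obtain ⟨η, hη0, hη⟩ := CkNorm_lt_of_forall_le
      (U := ball (0 : EuclideanSpace ℝ (Fin d)) 1) (k := k) hε
    obtain ⟨w, hws, hwc, hw⟩ := exists_compactSupport_near hu (ε := η / 3) (by positivity)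
    obtain ⟨p, hp⟩ := exists_mvPolynomial_iteratedFDeriv_near hws hwc (ε := η / 3) (by positivity)
    obtain ⟨e, hec, he, hmem⟩ := exists_rieszSpace_near_eval hs0 hs1 hd k p
      (ε := η / 3) (by positivity)
    refine ⟨_, hmem, hη _ fun α hα x => ?_⟩
    have hαk : ((∑ i, α i : ℕ) : WithTop ℕ∞) ≤ k := by exact_mod_cast hα
    have hpc : ContDiff ℝ k fun x : EuclideanSpace ℝ (Fin d) => MvPolynomial.eval x p :=
      contDiff_mvPolynomial_eval p
    have hVc : ContDiffAt ℝ k (zeroExtend (ball 0 1) u) x.1 :=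
      hu.1.contDiffAt (isOpen_ball.mem_nhds x.2)
    -- The three errors come from compact support, polynomial approximation and potentials, each at
    -- most `η / 3`.
    have hdec : ∀ y : ball (0 : EuclideanSpace ℝ (Fin d)) 1,
        (u - fun x : ball (0 : EuclideanSpace ℝ (Fin d)) 1 => MvPolynomial.eval x.1 p - e x) y =
        ((zeroExtend (ball 0 1) u - w) + ((w - fun x : EuclideanSpace ℝ (Fin d) => MvPolynomial.eval x p) + e)) y.1 := by
      intro y
      have : zeroExtend (ball 0 1) u y.1 = u y := Subtype.val_injective.extend_apply u 0 y
      simp only [Pi.sub_apply, Pi.add_apply, this]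
      ring
    rw [multiDeriv_eq isOpen_ball hdec]
    have c1 : ContDiffAt ℝ k (zeroExtend (ball 0 1) u - w) x.1 := hVc.sub hwc.contDiffAt
    have c2 : ContDiffAt ℝ k (w - fun x : EuclideanSpace ℝ (Fin d) => MvPolynomial.eval x p) x.1 := (hwc.sub hpc).contDiffAt
    have c3 : ContDiffAt ℝ k ((w - fun x : EuclideanSpace ℝ (Fin d) => MvPolynomial.eval x p) + e) x.1 :=
      c2.add hec.contDiffAt
    rw [iteratedFDeriv_add_apply (c1.of_le hαk) (c3.of_le hαk),
      iteratedFDeriv_sub_apply (hVc.of_le hαk) (hwc.contDiffAt.of_le hαk),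
      iteratedFDeriv_add_apply (c2.of_le hαk) (hec.contDiffAt.of_le hαk)]
    have b1 := hw α hα x
    have b2 := (norm_apply_basisTuple_le α _).trans (hp x.1 x.2 _ hα)
    have b3 := (norm_apply_basisTuple_le α _).trans (he x.1 x.2 _ hα)
    rw [multiDeriv_eq isOpen_ball
      (fun y => (Subtype.val_injective.extend_apply u 0 y).symm)] at b1
    simp only [_root_.add_apply, _root_.sub_apply]
    refine (abs_add_le _ _).trans ?_
    refine (add_le_add b1 ((abs_add_le _ _).trans (add_le_add b2 b3))).trans_eq ?_
    ring
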